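/- Let $\beta=(\beta_w)_{|w|\le 4}$ be real numbers indexed by the words $w$ of length at most $4$ in two noncommuting letters $X,Y$, with $\beta_v=\beta_w$ whenever $v$ is a cyclic permutation of $w$, $\beta_w=\beta_{w^*}$ ($w^*$ is the reversed word), and $\beta_1=1$. Assume that $\beta$ is noncommutative, i.e. $\beta_{X^2Y^2}\neq\beta_{XYXY}$. Let $\mathcal M_2=(\beta_{U^*V})_{|U|,|V|\le 2}$ be its moment matrix, with columns denoted by $\mathbb 1,\mathbb X,\mathbb Y,\mathbb X^2,\mathbb X\mathbb Y,\mathbb Y\mathbb X,\mathbb Y^2$. A representing measure for $\beta$ consists of finitely many pairs $(A_i,B_i)$ of real symmetric $t_i\times t_i$ matrices, $t_i\ge1$ (atoms of size $t_i$), and densities $\lambda_i>0$ with $\sum_i\lambda_i=1$, such that $\beta_w=\sum_i\lambda_i\frac1{t_i}\operatorname{tr}\,w(A_i,B_i)$ for all $|w|\le 4$. It is of type $(m_1,\dots,m_r)$ if it has exactly $m_s$ atoms of size $s$ for $1\le s\le r$, none of size larger than $r$, and $m_r\ne0$. It is minimal if no representing measure has a type $(m_1',\dots,m_{r'}')$ with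 $r'<r$, or with $r'=r$ and, for some $1\le s\le r$, $m_s'<m_s$ and $m_t'=m_t$ for all $s<t\le r$. The sequence $\beta$ admits a noncommutative (nc) measure if it has a minimal measure with $r>1$. Uniqueness of a measure is understood up to reordering the atoms and replacing each $(A_i,B_i)$ by $(U_iA_iU_i^t,U_iB_iU_i^t)$ with $U_i$ orthogonal. Suppose that $\mathcal M_2$ has rank $5$ and satisfies the column relations $\mathbb X\mathbb Y+\mathbb Y\mathbb X=\mathbf 0$ and $\mathbb Y^2-\mathbb X^2=\mathbb 1$. Then $\beta$ admits an nc measure exactly in the following cases: 1. $\mathcal M_2$ is positive semidefinite and $\beta_X=\beta_Y=0$. In this case the minimal measure exists, is unique, and is of type $(2,1)$. 2. $\mathcal M_2$ is positive semidefinite and $$\beta_X=0,\qquad 0<|\beta_Y|<1,\qquad \beta_{X^4}\ge\frac{\beta_{X^2}^2}{1-|\beta_Y|}.$$ In this case the minimal measure exists and is unique. It is of type $(1,1)$ if and only if $\beta_{X^4}=\frac{\beta_{X^2}^2}{1-|\beta_Y|}$; otherwise it is of type $(2,1)$. -/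

import Mathlib

namespace BQTMP

/-- The two noncommuting letters. -/
inductive Letter
  | X
  | Y
  deriving DecidableEq

open Letter

/-- Words of length at most `k` in `X, Y`; the empty word is the unit `1`. -/
abbrev WordLE (k : ℕ) : Type := {w : List Letter // w.length ≤ k}

/-- A sequence `β = (β_w)_{|w| ≤ 4}` with `β_v = β_w` whenever `v` is a cyclic permutation of `w`
and `β_w = β_{w*}`, where `w*` is the reverse of `w`. -/
structure TracialSeq where
  toFun : WordLE 4 → ℝ
  cyclic : ∀ v w : WordLE 4, v.1.IsRotated w.1 → toFun v = toFun w
  star : ∀ v w : WordLE 4, w.1 = v.1.reverse → toFun v = toFun w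

/-- The moment `β_w`. -/
def TracialSeq.moment (β : TracialSeq) (w : List Letter) (h : w.length ≤ 4 := by decide) : ℝ :=
  β.toFun ⟨w, h⟩

/-- `β` is normalized if `β_1 = 1`. -/
def TracialSeq.Normalized (β : TracialSeq) : Prop := β.moment [] = 1

/-- `β` is a noncommutative sequence if `β_{X²Y²} ≠ β_{XYXY}`. -/
def TracialSeq.Noncommutative (β : TracialSeq) : Prop :=
  β.moment [X, X, Y, Y] ≠ β.moment [X, Y, X, Y]

/-- The words of length at most two in degree-lexicographic order. -/
def basisWord : Fin 7 → WordLE 2 :=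
  ![⟨[], by decide⟩, ⟨[X], by decide⟩, ⟨[Y], by decide⟩, ⟨[X, X], by decide⟩,
    ⟨[X, Y], by decide⟩, ⟨[Y, X], by decide⟩, ⟨[Y, Y], by decide⟩]

/-- The entry `β_{U* V}` for words `U, V` of length at most two. -/
def TracialSeq.entry (β : TracialSeq) (U V : WordLE 2) : ℝ :=
  β.moment (U.1.reverse ++ V.1) (by
    have hU := U.2
    have hV := V.2
    simp only [List.length_append, List.length_reverse]
    omega)

/-- The truncated moment matrix `M₂` of order two. -/
def TracialSeq.M₂ (β : TracialSeq) : Matrix (Fin 7) (Fin 7) ℝ :=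
  Matrix.of fun i j => β.entry (basisWord i) (basisWord j)

/-- The column of `M₂` indexed by the word `w`. -/
def TracialSeq.column (β : TracialSeq) (w : List Letter) (h : w.length ≤ 2 := by decide) :
    Fin 7 → ℝ :=
  fun i => β.entry (basisWord i) ⟨w, h⟩

/-- An atom: a pair of real symmetric matrices of the same positive size. -/
structure Atom where
  size : ℕ
  size_pos : 0 < size
  A : Matrix (Fin size) (Fin size) ℝ
  B : Matrix (Fin size) (Fin size) ℝ
  symmA : A.IsSymm
  symmB : B.IsSymm

/-- The matrix `w(A, B)`. -/
def Atom.eval (a : Atom) (w : List Letter) : Matrix (Fin a.size) (Fin a.size) ℝ :=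
  (w.map fun l => match l with
    | X => a.A
    | Y => a.B).prod

/-- The normalized trace of `w(A, B)`. -/
noncomputable def Atom.trace (a : Atom) (w : List Letter) : ℝ :=
  (a.eval w).trace / (a.size : ℝ)

/-- Orthogonal equivalence of atoms. The two identities `U Uᵗ = 1`, `Uᵗ U = 1` force the sizes
to agree, so `U` is an orthogonal matrix. -/
def Atom.OrthEquiv (a b : Atom) : Prop :=
  ∃ U : Matrix (Fin b.size) (Fin a.size) ℝ,
    U * U.transpose = 1 ∧ U.transpose * U = 1 ∧
      b.A = U * a.A * U.transpose ∧ b.B = U * a.B * U.transpose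

/-- A finitely atomic measure: finitely many atoms with positive densities of total mass one. -/
structure AtomicMeasure where
  N : ℕ
  atom : Fin N → Atom
  density : Fin N → ℝ
  density_pos : ∀ i, 0 < density i
  density_sum : ∑ i, density i = 1

namespace AtomicMeasure

/-- `μ` is a representing measure for `β`. -/
def Represents (μ : AtomicMeasure) (β : TracialSeq) : Prop :=
  ∀ w : WordLE 4, β.toFun w = ∑ i, μ.density i * (μ.atom i).trace w.1

/-- The number `m_s` of atoms of size `s`. -/
def mult (μ : AtomicMeasure) (s : ℕ) : ℕ :=
  (Finset.univ.filter fun i => (μ.atom i).size = s).card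

/-- The largest size `r` of an atom. -/
def maxSize (μ : AtomicMeasure) : ℕ :=
  Finset.univ.sup fun i => (μ.atom i).size

/-- The type `(m_1, …, m_r)`. -/
def type (μ : AtomicMeasure) : List ℕ :=
  (List.range μ.maxSize).map fun s => μ.mult (s + 1)

/-- The type `(m_1, …, m_r)` of `μ` is strictly smaller than the type `(m'_1, …, m'_{r'})` of `ν`:
either `r < r'`, or `r = r'` and for some `1 ≤ s ≤ r` one has `m_s < m'_s`
and `m_t = m'_t` for all `s < t ≤ r`. -/
def Smaller (μ ν : AtomicMeasure) : Prop :=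
  μ.maxSize < ν.maxSize ∨
    (μ.maxSize = ν.maxSize ∧ ∃ s, 1 ≤ s ∧ s ≤ ν.maxSize ∧ μ.mult s < ν.mult s ∧
      ∀ t, s < t → t ≤ ν.maxSize → μ.mult t = ν.mult t)

/-- `μ` is a minimal representing measure for `β`. -/
def IsMinimal (μ : AtomicMeasure) (β : TracialSeq) : Prop :=
  μ.Represents β ∧ ∀ ν : AtomicMeasure, ν.Represents β → ¬ ν.Smaller μ

/-- Equality of measures up to the order of the atoms and orthogonal equivalence of each atom. -/
def OrthEquiv (μ ν : AtomicMeasure) : Prop :=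
  ∃ e : Fin μ.N ≃ Fin ν.N, ∀ i,
    ν.density (e i) = μ.density i ∧ (μ.atom i).OrthEquiv (ν.atom (e i))

end AtomicMeasure

/-- `β` admits a noncommutative measure: a minimal measure of type `(m_1, …, m_r)` with `r > 1`. -/
def TracialSeq.AdmitsNCMeasure (β : TracialSeq) : Prop :=
  ∃ μ : AtomicMeasure, μ.IsMinimal β ∧ 1 < μ.maxSize

/-- A minimal measure exists and is unique up to orthogonal equivalence. -/
def TracialSeq.HasUniqueMinimalMeasure (β : TracialSeq) : Prop :=
  ∃ μ : AtomicMeasure, μ.IsMinimal β ∧ ∀ ν : AtomicMeasure, ν.IsMinimal β → μ.OrthEquiv ν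

/-- The condition `β_X = 0`, `0 < |β_Y| < 1`, `β_{X⁴} ≥ β_{X²}² / (1 - |β_Y|)`. -/
def TracialSeq.CondTwo (β : TracialSeq) : Prop :=
  β.moment [X] = 0 ∧ 0 < |β.moment [Y]| ∧ |β.moment [Y]| < 1 ∧
    β.moment [X, X, X, X] ≥ β.moment [X, X] ^ 2 / (1 - |β.moment [Y]|)

end BQTMP

/-! With `β_X = 0`, the column relations and traciality leave only three free moments: `y = β_Y`, `a
= β_{X²}` and `c = β_{X⁴}`. A representing measure makes `M₂` a sum of Gram matrices, so kernel
vectors of `M₂` vanish on every atom, and each atom satisfies `AB = -BA` and `B² = 1 + A²`. Then `B`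
is invertible and anticommutation gives `tr A = 0`, which forces `β_X = 0`.

The remaining necessary condition is `a² ≤ c (1 - |y|)`. Put `C = B⁻¹`. It has the same trace as `B`
and satisfies `C² + CA²C = 1`, so for `ε = ±1` the matrix `2(1 + εC) = (1 + εC)² + CA²C` is positive
semidefinite. Compressing by `1 - sA²`, taking traces and averaging over the atoms gives a quadratic
in `s` that is nonnegative everywhere; its discriminant is the condition (`trace_quadratic_nonneg`,
`sq_le_mul`).

Conversely, three model atoms suffice: `(0, 1)`, `(0, -1)` and one atom of size two with parameter
`α > 0`. Matching moments forces `α² = c/a`, weight `q = a²/c` on the large atom, and `(1 - q ±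
y)/2` on the small ones. These weights are nonnegative exactly when `q ≤ 1 - |y|`, and a small atom
drops out at equality.

Noncommutativity rules out measures with only atoms of size one, so a minimal measure has exactly
one atom of size two. All its atoms are then model atoms up to orthogonal equivalence, whence
uniqueness (`hasUniqueMinimalMeasure`). Rank `5` supplies `a > 0` and, when `y = 0`, the strict
inequality `a² < c`. -/

namespace BQTMP

open Letter Matrix

/-! ### Sequences satisfying the column relations -/

/-- The moments of a sequence satisfying `XY + YX = 0`, `Y² - X² = 1` and `β_X = 0`, in terms of
`y = β_Y`, `a = β_{X²}` and `c = β_{X⁴}`. -/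
def reducedMoment (y a c : ℝ) : List Letter → ℝ
  | [] => 1
  | [Y] => y
  | [X, X] => a
  | [Y, Y] => 1 + a
  | [Y, Y, Y] => y
  | [X, X, X, X] => c
  | [X, X, Y, Y] => a + c
  | [X, Y, Y, X] => a + c
  | [Y, Y, X, X] => a + c
  | [Y, X, X, Y] => a + c
  | [X, Y, X, Y] => -(a + c)
  | [Y, X, Y, X] => -(a + c)
  | [Y, Y, Y, Y] => 1 + 2 * a + c
  | _ => 0

theorem forall_wordLE_four {P : List Letter → Prop}
    (h0 : P []) (h1 : ∀ i, P [i]) (h2 : ∀ i j, P [i, j]) (h3 : ∀ i j k, P [i, j, k])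
    (h4 : ∀ i j k l, P [i, j, k, l]) (w : WordLE 4) : P w.1 := by
  obtain ⟨w, hw⟩ := w
  rcases w with _ | ⟨i, _ | ⟨j, _ | ⟨k, _ | ⟨l, _ | ⟨m, w⟩⟩⟩⟩⟩
  · exact h0
  · exact h1 i
  · exact h2 i j
  · exact h3 i j k
  · exact h4 i j k l
  · simp only [List.length_cons] at hw
    omega

theorem TracialSeq.moment_rotate (β : TracialSeq) {v w : List Letter} {hv : v.length ≤ 4}
    {hw : w.length ≤ 4} (h : v ~r w) : β.moment v hv = β.moment w hw :=
  β.cyclic _ _ h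

theorem TracialSeq.toFun_eq_reducedMoment {β : TracialSeq} (hnorm : β.Normalized)
    (hrel₁ : β.column [X, Y] + β.column [Y, X] = 0)
    (hrel₂ : β.column [Y, Y] - β.column [X, X] = β.column [])
    (hX : β.moment [X] = 0) (w : WordLE 4) :
    β.toFun w = reducedMoment (β.moment [Y]) (β.moment [X, X]) (β.moment [X, X, X, X]) w.1 := by
  -- Each row of a column relation is a linear relation between moments. Combined with the rotations
  -- below, the first relation doubles a moment to zero in every row used except row 4, where it
  -- gives `β_{XYXY} = -β_{X²Y²}`.
  have r0 : β.moment [X, Y] + β.moment [Y, X] = 0 := congrFun hrel₁ 0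
  have r1 : β.moment [X, X, Y] + β.moment [X, Y, X] = 0 := congrFun hrel₁ 1
  have r2 : β.moment [Y, X, Y] + β.moment [Y, Y, X] = 0 := congrFun hrel₁ 2
  have r3 : β.moment [X, X, X, Y] + β.moment [X, X, Y, X] = 0 := congrFun hrel₁ 3
  have r4 : β.moment [Y, X, X, Y] + β.moment [Y, X, Y, X] = 0 := congrFun hrel₁ 4
  have r6 : β.moment [Y, Y, X, Y] + β.moment [Y, Y, Y, X] = 0 := congrFun hrel₁ 6
  have s0 : β.moment [Y, Y] - β.moment [X, X] = β.moment [] := congrFun hrel₂ 0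
  have s1 : β.moment [X, Y, Y] - β.moment [X, X, X] = β.moment [X] := congrFun hrel₂ 1
  have s2 : β.moment [Y, Y, Y] - β.moment [Y, X, X] = β.moment [Y] := congrFun hrel₂ 2
  have s3 : β.moment [X, X, Y, Y] - β.moment [X, X, X, X] = β.moment [X, X] := congrFun hrel₂ 3
  have s6 : β.moment [Y, Y, Y, Y] - β.moment [Y, Y, X, X] = β.moment [Y, Y] := congrFun hrel₂ 6
  have hn : β.moment [] = 1 := hnorm
  have t0 : β.moment [Y, X] = β.moment [X, Y] := β.moment_rotate (by decide)
  have t1 : β.moment [X, Y, X] = β.moment [X, X, Y] := β.moment_rotate (by decide)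
  have t2 : β.moment [Y, X, X] = β.moment [X, X, Y] := β.moment_rotate (by decide)
  have t3 : β.moment [Y, X, Y] = β.moment [X, Y, Y] := β.moment_rotate (by decide)
  have t4 : β.moment [Y, Y, X] = β.moment [X, Y, Y] := β.moment_rotate (by decide)
  have t5 : β.moment [X, X, Y, X] = β.moment [X, X, X, Y] := β.moment_rotate (by decide)
  have t6 : β.moment [X, Y, X, X] = β.moment [X, X, X, Y] := β.moment_rotate (by decide)
  have t7 : β.moment [Y, X, X, X] = β.moment [X, X, X, Y] := β.moment_rotate (by decide)
  have t8 : β.moment [X, Y, Y, X] = β.moment [X, X, Y, Y] := β.moment_rotate (by decide)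
  have t9 : β.moment [Y, Y, X, X] = β.moment [X, X, Y, Y] := β.moment_rotate (by decide)
  have t10 : β.moment [Y, X, X, Y] = β.moment [X, X, Y, Y] := β.moment_rotate (by decide)
  have t11 : β.moment [Y, X, Y, X] = β.moment [X, Y, X, Y] := β.moment_rotate (by decide)
  have t12 : β.moment [Y, X, Y, Y] = β.moment [X, Y, Y, Y] := β.moment_rotate (by decide)
  have t13 : β.moment [Y, Y, X, Y] = β.moment [X, Y, Y, Y] := β.moment_rotate (by decide)
  have t14 : β.moment [Y, Y, Y, X] = β.moment [X, Y, Y, Y] := β.moment_rotate (by decide)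
  suffices h : ∀ hw : w.1.length ≤ 4, β.moment w.1 hw =
      reducedMoment (β.moment [Y]) (β.moment [X, X]) (β.moment [X, X, X, X]) w.1 from h w.2
  refine forall_wordLE_four (P := fun w => ∀ hw : w.length ≤ 4, β.moment w hw = reducedMoment
    (β.moment [Y]) (β.moment [X, X]) (β.moment [X, X, X, X]) w) ?_ ?_ ?_ ?_ ?_ w
  · intro _; exact hn
  · rintro (_ | _) _ <;> simp only [reducedMoment] <;> linarith
  · rintro (_ | _) (_ | _) _ <;> simp only [reducedMoment] <;> linarith
  · rintro (_ | _) (_ | _) (_ | _) _ <;> simp only [reducedMoment] <;> linarith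
  · rintro (_ | _) (_ | _) (_ | _) (_ | _) _ <;> simp only [reducedMoment] <;> linarith

/-- The relations express the columns of `YX` and `Y²` through the other five, which therefore span
a column space of dimension five. -/
theorem TracialSeq.linearIndependent_columns {β : TracialSeq}
    (hrel₁ : β.column [X, Y] + β.column [Y, X] = 0)
    (hrel₂ : β.column [Y, Y] - β.column [X, X] = β.column []) (hrank : β.M₂.rank = 5) :
    LinearIndependent ℝ
      ![β.column [], β.column [X], β.column [Y], β.column [X, X], β.column [X, Y]] := by
  set b := ![β.column [], β.column [X], β.column [Y], β.column [X, X], β.column [X, Y]] with hb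
  have hmem : ∀ i, b i ∈ Submodule.span ℝ (Set.range b) :=
    fun i => Submodule.subset_span ⟨i, rfl⟩
  have hle : Submodule.span ℝ (Set.range β.M₂.col) ≤ Submodule.span ℝ (Set.range b) := by
    rw [Submodule.span_le]
    rintro _ ⟨i, rfl⟩
    fin_cases i
    · exact hmem 0
    · exact hmem 1
    · exact hmem 2
    · exact hmem 3
    · exact hmem 4
    · have : β.column [Y, X] = -b 4 := (neg_eq_of_add_eq_zero_right hrel₁).symm
      change β.column [Y, X] ∈ _
      rw [this]
      exact Submodule.neg_mem _ (hmem 4)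
    · have : β.column [Y, Y] = b 0 + b 3 := sub_eq_iff_eq_add.1 hrel₂
      change β.column [Y, Y] ∈ _
      rw [this]
      exact Submodule.add_mem _ (hmem 0) (hmem 3)
  rw [linearIndependent_iff_card_le_finrank_span]
  rw [Matrix.rank_eq_finrank_span_cols] at hrank
  have := Submodule.finrank_mono hle
  simpa [Set.finrank, hrank] using this

/-- The only entry of the column of `X` that can be nonzero is `β_{X²}`, and this column cannot
vanish. -/
theorem TracialSeq.moment_sq_pos {β : TracialSeq} (hnorm : β.Normalized)
    (hrel₁ : β.column [X, Y] + β.column [Y, X] = 0)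
    (hrel₂ : β.column [Y, Y] - β.column [X, X] = β.column []) (hrank : β.M₂.rank = 5)
    (hX : β.moment [X] = 0) (hM : β.M₂.PosSemidef) : 0 < β.moment [X, X] := by
  have hred := β.toFun_eq_reducedMoment hnorm hrel₁ hrel₂ hX
  have h0 : 0 ≤ β.moment [X, X] := hM.diag_nonneg (i := 1)
  refine h0.lt_of_ne fun ha => (linearIndependent_columns hrel₁ hrel₂ hrank).ne_zero 1 ?_
  change β.column [X] = 0
  funext i
  fin_cases i
  · exact hX
  · exact ha.symm
  all_goals exact hred _

theorem TracialSeq.moment_sq_lt {β : TracialSeq} (hnorm : β.Normalized)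
    (hrel₁ : β.column [X, Y] + β.column [Y, X] = 0)
    (hrel₂ : β.column [Y, Y] - β.column [X, X] = β.column []) (hrank : β.M₂.rank = 5)
    (hX : β.moment [X] = 0) (hY : β.moment [Y] = 0) (hM : β.M₂.PosSemidef) :
    β.moment [X, X] ^ 2 < β.moment [X, X, X, X] := by
  have hred := β.toFun_eq_reducedMoment hnorm hrel₁ hrel₂ hX
  set a := β.moment [X, X] with ha
  set c := β.moment [X, X, X, X] with hc
  rw [hY] at hred
  have h00 : β.M₂ 0 0 = 1 := hred _
  have h03 : β.M₂ 0 3 = a := hred _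
  have h30 : β.M₂ 3 0 = a := hred _
  have h33 : β.M₂ 3 3 = c := hred _
  have hle : a ^ 2 ≤ c := by
    -- The vector of the polynomial `X² - a`.
    have := hM.dotProduct_mulVec_nonneg ![-a, 0, 0, 1, 0, 0, 0]
    simp [Matrix.mulVec, dotProduct, Fin.sum_univ_succ] at this
    simp only [h00, h03, h30, h33] at this
    nlinarith
  refine hle.lt_of_ne fun h => ?_
  -- If `c = a²` and `y = 0`, the column of `X²` is `a` times the column of `1`, contradicting
  -- independence.
  have hli := (linearIndependent_columns hrel₁ hrel₂ hrank)
  rw [Fintype.linearIndependent_iff] at hli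
  have := hli ![-a, 0, 0, 1, 0] ?_ 3
  · simp at this
  have hcol : β.column [X, X] = a • β.column [] := by
    funext i
    change β.M₂ i 3 = a * β.M₂ i 0
    fin_cases i
    · change β.M₂ 0 3 = a * β.M₂ 0 0
      rw [h03, h00, mul_one]
    · change β.M₂ 1 3 = a * β.M₂ 1 0
      rw [show β.M₂ 1 3 = 0 from hred _, show β.M₂ 1 0 = 0 from hred _, mul_zero]
    · change β.M₂ 2 3 = a * β.M₂ 2 0
      rw [show β.M₂ 2 3 = 0 from hred _, show β.M₂ 2 0 = 0 from hred _, mul_zero]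
    · change β.M₂ 3 3 = a * β.M₂ 3 0
      rw [h33, h30, ← h, sq]
    · change β.M₂ 4 3 = a * β.M₂ 4 0
      rw [show β.M₂ 4 3 = 0 from hred _, show β.M₂ 4 0 = 0 from hred _, mul_zero]
    · change β.M₂ 5 3 = a * β.M₂ 5 0
      rw [show β.M₂ 5 3 = 0 from hred _, show β.M₂ 5 0 = 0 from hred _, mul_zero]
    · change β.M₂ 6 3 = a * β.M₂ 6 0
      rw [show β.M₂ 6 3 = a + c from hred _, show β.M₂ 6 0 = 1 + a from hred _, ← h]
      ring
  simp [Fin.sum_univ_succ, hcol]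

end BQTMP

namespace BQTMP

open Letter Matrix

/-! ### Traces of atoms -/

theorem trace_transpose_mul_self_nonneg {n : ℕ} (P : Matrix (Fin n) (Fin n) ℝ) :
    0 ≤ (Pᵀ * P).trace := by
  simpa using (posSemidef_conjTranspose_mul_self P).trace_nonneg

theorem Atom.eval_reverse (a : Atom) (w : List Letter) : a.eval w.reverse = (a.eval w)ᵀ := by
  induction w with
  | nil => simp [eval]
  | cons l w ih =>
    simp only [eval, List.map_reverse] at ih
    simp only [eval, List.reverse_cons, List.map_append, List.prod_append, List.map_reverse, ih,
      List.map_cons, List.prod_cons, Matrix.transpose_mul]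
    cases l <;> simp [a.symmA.eq, a.symmB.eq]

theorem Atom.eval_append (a : Atom) (v w : List Letter) :
    a.eval (v ++ w) = a.eval v * a.eval w := by
  simp [eval]

/-- The value of a noncommutative polynomial of degree at most two. -/
noncomputable def Atom.evalQuadratic (a : Atom) (v : Fin 7 → ℝ) :
    Matrix (Fin a.size) (Fin a.size) ℝ :=
  ∑ i, v i • a.eval (basisWord i).1

/-- Since `A` and `B` are symmetric, `β_{U*V}` is the average of the normalized traces of `U(A, B)ᵀ
V(A, B)`; expand bilinearly. Positivity of `M₂` and the relations on the atoms both follow from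
this. -/
theorem AtomicMeasure.Represents.quadratic_form {μ : AtomicMeasure} {β : TracialSeq}
    (h : μ.Represents β) (v : Fin 7 → ℝ) :
    v ⬝ᵥ (β.M₂ *ᵥ v) = ∑ i, μ.density i *
      ((((μ.atom i).evalQuadratic v)ᵀ * (μ.atom i).evalQuadratic v).trace / (μ.atom i).size) := by
  have hentry : ∀ j k, β.M₂ j k = ∑ i, μ.density i *
      ((((μ.atom i).eval (basisWord j).1)ᵀ * (μ.atom i).eval (basisWord k).1).trace /
        (μ.atom i).size) := by
    intro j k
    refine (h _).trans (Finset.sum_congr rfl fun i _ => ?_)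
    rw [Atom.trace, Atom.eval_append, Atom.eval_reverse]
  simp only [dotProduct, mulVec, hentry, Atom.evalQuadratic, transpose_sum, transpose_smul,
    Finset.sum_mul, Finset.mul_sum, smul_mul_assoc, mul_smul_comm, trace_sum, trace_smul,
    smul_eq_mul, Finset.sum_div]
  rw [Finset.sum_comm' (t' := Finset.univ) (s' := fun _ => Finset.univ) (by simp)]
  conv_rhs => rw [Finset.sum_comm]
  refine Finset.sum_congr rfl fun j _ => ?_
  conv_rhs => rw [Finset.sum_comm]
  refine Finset.sum_congr rfl fun k _ => Finset.sum_congr rfl fun i _ => ?_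
  ring

theorem AtomicMeasure.Represents.posSemidef {μ : AtomicMeasure} {β : TracialSeq}
    (h : μ.Represents β) : β.M₂.PosSemidef := by
  refine PosSemidef.of_dotProduct_mulVec_nonneg ?_ fun v => ?_
  · ext i j
    refine β.star _ _ ?_
    simp
  · rw [star_trivial, h.quadratic_form v]
    exact Finset.sum_nonneg fun i _ => mul_nonneg (μ.density_pos i).le
      (div_nonneg (trace_transpose_mul_self_nonneg _) (Nat.cast_nonneg _))

theorem AtomicMeasure.Represents.evalQuadratic_eq_zero {μ : AtomicMeasure} {β : TracialSeq}
    (h : μ.Represents β) {v : Fin 7 → ℝ} (hv : β.M₂ *ᵥ v = 0) (i : Fin μ.N) :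
    (μ.atom i).evalQuadratic v = 0 := by
  have hq := h.quadratic_form v
  rw [hv, dotProduct_zero, eq_comm, Finset.sum_eq_zero_iff_of_nonneg fun i _ =>
    mul_nonneg (μ.density_pos i).le
      (div_nonneg (trace_transpose_mul_self_nonneg _) (Nat.cast_nonneg _))] at hq
  have hi := hq i (Finset.mem_univ i)
  have hs : ((μ.atom i).size : ℝ) ≠ 0 := Nat.cast_ne_zero.2 (μ.atom i).size_pos.ne'
  rw [mul_eq_zero_iff_left (μ.density_pos i).ne', div_eq_zero_iff, or_iff_left hs] at hi
  rw [← conjTranspose_eq_transpose_of_trivial] at hi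
  exact trace_conjTranspose_mul_self_eq_zero_iff.1 hi

/-- The pair `(A, B)` satisfies `AB + BA = 0` and `B² = 1 + A²`. -/
structure Atom.SatisfiesRelations (a : Atom) : Prop where
  anticomm : a.A * a.B = -(a.B * a.A)
  sq_eq : a.B * a.B = 1 + a.A * a.A

theorem AtomicMeasure.Represents.satisfiesRelations {μ : AtomicMeasure} {β : TracialSeq}
    (h : μ.Represents β) (hrel₁ : β.column [X, Y] + β.column [Y, X] = 0)
    (hrel₂ : β.column [Y, Y] - β.column [X, X] = β.column []) (i : Fin μ.N) :
    (μ.atom i).SatisfiesRelations := by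
  -- The two kernel vectors are the coefficients of `XY + YX` and of `Y² - X² - 1` in the order of
  -- `basisWord`.
  have h₁ := h.evalQuadratic_eq_zero (v := ![0, 0, 0, 0, 1, 1, 0]) (by
    funext j
    have : β.M₂ j 4 + β.M₂ j 5 = 0 := congrFun hrel₁ j
    simpa [mulVec, dotProduct, Fin.sum_univ_succ] using this) i
  have h₂ := h.evalQuadratic_eq_zero (v := ![-1, 0, 0, -1, 0, 0, 1]) (by
    funext j
    have : β.M₂ j 6 - β.M₂ j 3 = β.M₂ j 0 := congrFun hrel₂ j
    have h' : -β.M₂ j 0 + (-β.M₂ j 3 + β.M₂ j 6) = 0 := by linarith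
    simpa [mulVec, dotProduct, Fin.sum_univ_succ] using h') i
  simp [Atom.evalQuadratic, Fin.sum_univ_succ, basisWord, Atom.eval] at h₁ h₂
  refine ⟨eq_neg_of_add_eq_zero_left h₁, ?_⟩
  rw [← sub_eq_zero, ← h₂]
  abel

namespace Atom.SatisfiesRelations

variable {a : Atom}

theorem isUnit_det (h : a.SatisfiesRelations) : IsUnit a.B.det := by
  have hpos : (a.B * a.B).PosDef := by
    rw [h.sq_eq]
    refine PosDef.one.add_posSemidef ?_
    have := posSemidef_conjTranspose_mul_self a.A
    rwa [conjTranspose_eq_transpose_of_trivial, a.symmA.eq] at this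
  have := hpos.det_pos
  rw [det_mul] at this
  exact isUnit_iff_ne_zero.2 fun h0 => by simp [h0] at this

theorem inv_mul (h : a.SatisfiesRelations) : a.B⁻¹ * a.B = 1 := nonsing_inv_mul _ h.isUnit_det

theorem mul_inv (h : a.SatisfiesRelations) : a.B * a.B⁻¹ = 1 := mul_nonsing_inv _ h.isUnit_det

theorem trace_A (h : a.SatisfiesRelations) : a.A.trace = 0 := by
  have h1 : (a.A * a.B * a.B⁻¹).trace = a.A.trace := by
    rw [mul_assoc, h.mul_inv, mul_one]
  rw [h.anticomm, neg_mul, trace_neg, trace_mul_comm, ← mul_assoc, h.inv_mul, one_mul] at h1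
  linarith

theorem inv_anticomm (h : a.SatisfiesRelations) : a.A * a.B⁻¹ = -(a.B⁻¹ * a.A) := by
  have : a.B⁻¹ * (a.A * a.B) * a.B⁻¹ = a.B⁻¹ * (-(a.B * a.A)) * a.B⁻¹ := by rw [h.anticomm]
  rw [mul_assoc, mul_assoc, h.mul_inv, mul_one, mul_neg, neg_mul, ← mul_assoc a.B⁻¹, h.inv_mul,
    one_mul] at this
  rw [this, neg_neg]

/-- `tr B⁻¹ = tr B`, because `B⁻¹` anticommutes with `A` and `B = B⁻¹ (1 + A²)`. -/
theorem trace_inv (h : a.SatisfiesRelations) : a.B⁻¹.trace = a.B.trace := by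
  have h1 : a.B = a.B⁻¹ + a.B⁻¹ * a.A * a.A := by
    have : a.B⁻¹ * (a.B * a.B) = a.B⁻¹ * (1 + a.A * a.A) := by rw [h.sq_eq]
    rwa [← mul_assoc, h.inv_mul, one_mul, mul_add, mul_one, ← mul_assoc] at this
  have h2 : (a.B⁻¹ * a.A * a.A).trace = 0 := by
    have h3 := trace_mul_comm (a.B⁻¹ * a.A) a.A
    rw [← mul_assoc, h.inv_anticomm, neg_mul, trace_neg] at h3
    linarith
  have := congrArg Matrix.trace h1
  rw [trace_add, h2, add_zero] at this
  exact this.symm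

/-- This is half the trace of `D · 2(1 + εC) · D` with `C = B⁻¹` and `D = 1 - sA²`, and `2(1 + εC)`
is the sum of squares `(1 + εC)² + (AC)ᵀ(AC)`. -/
theorem trace_quadratic_nonneg (h : a.SatisfiesRelations) (s ε : ℝ) (hε : ε ^ 2 = 1) :
    0 ≤ (a.size : ℝ) + ε * a.B.trace - 2 * s * (a.A * a.A).trace +
      s ^ 2 * (a.A * a.A * a.A * a.A).trace := by
  set C := a.B⁻¹ with hC
  set A := a.A with hA
  set D := 1 - s • (A * A) with hD
  have hAC : A * C = -(C * A) := h.inv_anticomm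
  -- This is `C B² C = 1` with `B²` replaced by `1 + A²`.
  have hCC : C * C + (C * A) * (A * C) = 1 := by
    have : C * (a.B * a.B) * C = C * (1 + A * A) * C := by rw [h.sq_eq]
    rw [← mul_assoc C, h.inv_mul, one_mul, h.mul_inv] at this
    rw [this]
    noncomm_ring
  have hDT : Dᵀ = D := by simp [hD, hA, a.symmA.eq]
  have hCT : Cᵀ = C := by rw [hC, transpose_nonsing_inv, a.symmB.eq]
  have hAT : Aᵀ = A := a.symmA.eq
  have n1 := trace_transpose_mul_self_nonneg ((1 + ε • C) * D)
  have n2 := trace_transpose_mul_self_nonneg (A * C * D)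
  have e1 : ((1 + ε • C) * D)ᵀ * ((1 + ε • C) * D) =
      D * (1 + (2 * ε) • C + C * C) * D := by
    have : (1 + ε • C) * (1 + ε • C) = 1 + (2 * ε) • C + C * C := by
      rw [add_mul, one_mul, mul_add, mul_one, smul_mul_smul_comm, ← sq ε, hε, one_smul, two_mul,
        add_smul]
      abel
    rw [← this, transpose_mul, transpose_add, transpose_smul, transpose_one, hCT, hDT]
    simp only [mul_assoc]
  have e2 : (A * C * D)ᵀ * (A * C * D) = D * ((C * A) * (A * C)) * D := by
    rw [transpose_mul, transpose_mul, hCT, hDT, hAT]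
    simp only [mul_assoc]
  have e3 : D * (1 + (2 * ε) • C + C * C) * D + D * ((C * A) * (A * C)) * D =
      (2 : ℝ) • (D * D) + (2 * ε) • (D * C * D) := by
    rw [← add_mul, ← mul_add, add_assoc, hCC, add_right_comm, mul_add, add_mul, two_smul]
    simp [mul_add, add_mul]
  have e4 := congrArg Matrix.trace e3
  rw [← e1, ← e2, trace_add, trace_add, trace_smul, trace_smul, smul_eq_mul, smul_eq_mul] at e4
  -- Moving `A` cyclically to the front and then past `C` reverses the sign. Hence only the constant
  -- term of `D²` contributes to `tr (C D²)`.
  have z : ∀ M, A * M = M * A → (C * (M * A)).trace = 0 := by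
    intro M hM
    have h3 := trace_mul_comm (C * M) A
    rw [← mul_assoc, hAC, neg_mul, trace_neg, mul_assoc, mul_assoc, hM] at h3
    linarith
  have z1 : (C * (A * A)).trace = 0 := z A rfl
  have z2 : (C * (A * A * A * A)).trace = 0 := z (A * A * A) (by simp only [mul_assoc])
  have f1 : (D * D).trace = a.size - 2 * s * (A * A).trace + s ^ 2 * (A * A * A * A).trace := by
    simp only [hD, sub_mul, mul_sub, one_mul, mul_one, smul_mul_assoc, mul_smul_comm, trace_sub,
      trace_smul, trace_one, Fintype.card_fin, smul_eq_mul, ← mul_assoc]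
    ring
  have f2 : (D * C * D).trace = a.B.trace := by
    rw [trace_mul_comm, ← mul_assoc, trace_mul_comm]
    simp only [hD, sub_mul, mul_sub, one_mul, mul_one, smul_mul_assoc, mul_smul_comm, trace_sub,
      trace_smul, smul_eq_mul]
    rw [z1, ← mul_assoc (A * A), z2, h.trace_inv]
    ring
  rw [f1, f2] at e4
  linarith

end Atom.SatisfiesRelations

end BQTMP

namespace BQTMP

open Letter Matrix

/-! ### Necessary conditions for a representing measure -/

namespace AtomicMeasure

theorem size_le_maxSize (μ : AtomicMeasure) (i : Fin μ.N) : (μ.atom i).size ≤ μ.maxSize :=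
  Finset.le_sup (f := fun i => (μ.atom i).size) (Finset.mem_univ i)

theorem exists_size_eq_maxSize (μ : AtomicMeasure) : ∃ i, (μ.atom i).size = μ.maxSize := by
  have hne : (Finset.univ : Finset (Fin μ.N)).Nonempty := by
    rw [Finset.nonempty_iff_ne_empty]
    intro h0
    have := μ.density_sum
    simp [h0] at this
  obtain ⟨i, -, hi⟩ := Finset.exists_mem_eq_sup _ hne fun i => (μ.atom i).size
  exact ⟨i, hi.symm⟩

namespace Represents

variable {μ : AtomicMeasure} {β : TracialSeq}

theorem one_lt_maxSize (h : μ.Represents β) (hnc : β.Noncommutative) : 1 < μ.maxSize := by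
  by_contra hle
  refine hnc ((h _).trans (Eq.trans (Finset.sum_congr rfl fun i _ => ?_) (h _).symm))
  have h1 : (μ.atom i).size = 1 :=
    le_antisymm ((μ.size_le_maxSize i).trans (not_lt.1 hle)) (μ.atom i).size_pos
  have hcomm : (μ.atom i).A * (μ.atom i).B = (μ.atom i).B * (μ.atom i).A := by
    generalize μ.atom i = a at h1 ⊢
    obtain ⟨n, hn, A, B, hA, hB⟩ := a
    obtain rfl : n = 1 := h1
    ext j k
    fin_cases j; fin_cases k
    simp [mul_apply, mul_comm]
  simp only [Atom.trace, Atom.eval, List.map_cons, List.map_nil, List.prod_cons, List.prod_nil,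
    mul_one]
  rw [← mul_assoc (μ.atom i).B, ← hcomm, mul_assoc]

theorem moment_X (h : μ.Represents β) (hrel₁ : β.column [X, Y] + β.column [Y, X] = 0)
    (hrel₂ : β.column [Y, Y] - β.column [X, X] = β.column []) : β.moment [X] = 0 := by
  refine (h _).trans (Finset.sum_eq_zero fun i _ => ?_)
  simp [Atom.trace, Atom.eval, (h.satisfiesRelations hrel₁ hrel₂ i).trace_A]

theorem quadratic_nonneg (h : μ.Represents β) (hrel₁ : β.column [X, Y] + β.column [Y, X] = 0)
    (hrel₂ : β.column [Y, Y] - β.column [X, X] = β.column []) (s ε : ℝ) (hε : ε ^ 2 = 1) :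
    0 ≤ 1 + ε * β.moment [Y] - 2 * s * β.moment [X, X] + s ^ 2 * β.moment [X, X, X, X] := by
  have e : 1 + ε * β.moment [Y] - 2 * s * β.moment [X, X] + s ^ 2 * β.moment [X, X, X, X] =
      ∑ i, μ.density i * (((μ.atom i).size + ε * (μ.atom i).B.trace
        - 2 * s * ((μ.atom i).A * (μ.atom i).A).trace
        + s ^ 2 * ((μ.atom i).A * (μ.atom i).A * (μ.atom i).A * (μ.atom i).A).trace) /
          (μ.atom i).size) := by
    simp only [TracialSeq.moment, h _, Finset.mul_sum]
    rw [← μ.density_sum, ← Finset.sum_add_distrib, ← Finset.sum_sub_distrib,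
      ← Finset.sum_add_distrib]
    refine Finset.sum_congr rfl fun i _ => ?_
    have hs : ((μ.atom i).size : ℝ) ≠ 0 := Nat.cast_ne_zero.2 (μ.atom i).size_pos.ne'
    simp only [Atom.trace, Atom.eval, List.map_cons, List.map_nil, List.prod_cons, List.prod_nil,
      mul_one, ← mul_assoc]
    field_simp
  rw [e]
  exact Finset.sum_nonneg fun i _ => mul_nonneg (μ.density_pos i).le (div_nonneg
    ((h.satisfiesRelations hrel₁ hrel₂ i).trace_quadratic_nonneg s ε hε) (Nat.cast_nonneg _))

theorem sq_le_mul (h : μ.Represents β) (hrel₁ : β.column [X, Y] + β.column [Y, X] = 0)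
    (hrel₂ : β.column [Y, Y] - β.column [X, X] = β.column []) :
    β.moment [X, X] ^ 2 ≤ β.moment [X, X, X, X] * (1 - |β.moment [Y]|) := by
  have hq : ∀ s : ℝ, 0 ≤ β.moment [X, X, X, X] * (s * s) + (-2 * β.moment [X, X]) * s +
      (1 - |β.moment [Y]|) := by
    intro s
    -- The sign `ε` is taken opposite to that of `β_Y`.
    rcases abs_cases (β.moment [Y]) with ⟨hy, -⟩ | ⟨hy, -⟩ <;> rw [hy]
    · linarith [h.quadratic_nonneg hrel₁ hrel₂ s (-1) (by norm_num)]
    · linarith [h.quadratic_nonneg hrel₁ hrel₂ s 1 (by norm_num)]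
  have := discrim_le_zero hq
  rw [discrim] at this
  linarith

end Represents

end AtomicMeasure

end BQTMP

namespace BQTMP

open Letter Matrix

/-! ### The irreducible atoms -/

theorem Atom.OrthEquiv.trace_eq {a b : Atom} (h : a.OrthEquiv b) (w : List Letter) :
    a.trace w = b.trace w := by
  obtain ⟨U, h1, h2, hA, hB⟩ := h
  have he : b.eval w = U * a.eval w * Uᵀ := by
    induction w with
    | nil => simp [eval, h1]
    | cons l w ih =>
      have hc : ∀ M : Matrix (Fin a.size) (Fin a.size) ℝ,
          U * M * Uᵀ * (U * a.eval w * Uᵀ) = U * (M * a.eval w) * Uᵀ := by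
        intro M
        rw [← Matrix.mul_assoc, ← Matrix.mul_assoc, Matrix.mul_assoc (U * M), h2, Matrix.mul_one,
          ← Matrix.mul_assoc U]
      have hcons : ∀ c : Atom, c.eval (l :: w) = (c.eval [l]) * c.eval w := by
        intro c; simp [eval]
      rw [hcons, hcons, ih, ← hc]
      cases l <;> simp [eval, hA, hB]
  have hs : (a.size : ℝ) = b.size := by
    have e1 := congrArg Matrix.trace h1
    have e2 := congrArg Matrix.trace h2
    rw [trace_mul_comm] at e1
    rw [e1] at e2
    simpa using e2.symm
  rw [trace, trace, he, trace_mul_comm, ← Matrix.mul_assoc, h2, Matrix.one_mul, hs]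

/-- The atom `(0, b)` of size one. -/
def atomOne (b : ℝ) : Atom where
  size := 1
  size_pos := one_pos
  A := 0
  B := !![b]
  symmA := by simp [IsSymm]
  symmB := by ext i j; fin_cases i; fin_cases j; rfl

/-- The atom of size two with `A = diag(α, -α)` and `B` antidiagonal with entries `√(1 + α²)`. -/
noncomputable def atomTwo (α : ℝ) : Atom where
  size := 2
  size_pos := two_pos
  A := !![α, 0; 0, -α]
  B := !![0, √(1 + α ^ 2); √(1 + α ^ 2), 0]
  symmA := by ext i j; fin_cases i <;> fin_cases j <;> rfl
  symmB := by ext i j; fin_cases i <;> fin_cases j <;> rfl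

/-- The substitution `X ↦ A`, `Y ↦ B`. -/
def letterMatrix {n : ℕ} (A B : Matrix (Fin n) (Fin n) ℝ) : Letter → Matrix (Fin n) (Fin n) ℝ
  | X => A
  | Y => B

theorem Atom.trace_mk {n : ℕ} (hn : 0 < n) (A B : Matrix (Fin n) (Fin n) ℝ) (hA : A.IsSymm)
    (hB : B.IsSymm) (w : List Letter) :
    (Atom.mk n hn A B hA hB).trace w = ((w.map (letterMatrix A B)).prod).trace / n := by
  have : (fun l : Letter => match l with
    | X => A
    | Y => B) = letterMatrix A B := by
    funext l
    cases l <;> rfl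
  rw [← this]
  rfl

theorem atomOne_trace {b : ℝ} (hb : b ^ 2 = 1) (w : WordLE 4) :
    (atomOne b).trace w.1 = reducedMoment b 0 0 w.1 := by
  have h2 : b * b = 1 := by linear_combination hb
  refine (Atom.trace_mk _ _ _ _ _ _).trans ?_
  refine forall_wordLE_four (P := fun w => ((w.map (letterMatrix (n := 1) 0 !![b])).prod).trace /
    (1 : ℕ) = reducedMoment b 0 0 w) ?_ ?_ ?_ ?_ ?_ w
  · simp [reducedMoment]
  · rintro (_ | _) <;> simp [letterMatrix, reducedMoment]
  · rintro (_ | _) (_ | _) <;> simp [letterMatrix, reducedMoment, h2]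
  · rintro (_ | _) (_ | _) (_ | _) <;> simp [letterMatrix, reducedMoment, h2]
  · rintro (_ | _) (_ | _) (_ | _) (_ | _) <;> simp [letterMatrix, reducedMoment, h2]

theorem atomTwo_trace (α : ℝ) (w : WordLE 4) :
    (atomTwo α).trace w.1 = reducedMoment 0 (α ^ 2) (α ^ 4) w.1 := by
  refine (Atom.trace_mk _ _ _ _ _ _).trans ?_
  have h2 : √(1 + α ^ 2) ^ 2 = 1 + α ^ 2 := Real.sq_sqrt (by positivity)
  generalize √(1 + α ^ 2) = t at h2
  have h4 : t ^ 4 = 1 + 2 * α ^ 2 + α ^ 4 := by linear_combination (t ^ 2 + 1 + α ^ 2) * h2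
  refine forall_wordLE_four (P := fun w =>
    ((w.map (letterMatrix !![α, 0; 0, -α] !![0, t; t, 0])).prod).trace / (2 : ℕ) =
      reducedMoment 0 (α ^ 2) (α ^ 4) w) ?_ ?_ ?_ ?_ ?_ w
  · simp [reducedMoment]
  · rintro (_ | _) <;> simp [letterMatrix, reducedMoment, trace_fin_two]
  · rintro (_ | _) (_ | _) <;> simp [letterMatrix, reducedMoment, trace_fin_two] <;>
      ring_nf <;> simp only [h2]
  · rintro (_ | _) (_ | _) (_ | _) <;> simp [letterMatrix, reducedMoment, trace_fin_two]
  · rintro (_ | _) (_ | _) (_ | _) (_ | _) <;>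
      simp [letterMatrix, reducedMoment, trace_fin_two] <;>
      ring_nf <;> simp only [h2, h4] <;> ring

/-- A matrix of size one with trace zero is zero, so `B² = 1`. -/
theorem Atom.SatisfiesRelations.orthEquiv_atomOne {a : Atom} (h : a.SatisfiesRelations)
    (hs : a.size = 1) : ∃ b : ℝ, b * b = 1 ∧ (atomOne b).OrthEquiv a := by
  obtain ⟨n, hn, A, B, hA, hB⟩ := a
  obtain rfl : n = 1 := hs
  have htr : A.trace = 0 := h.trace_A
  have hsq : B * B = 1 + A * A := h.sq_eq
  obtain rfl : A = 0 := by
    ext i j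
    fin_cases i; fin_cases j
    simpa [Matrix.trace] using htr
  have h1 : (1 : Matrix (Fin 1) (Fin 1) ℝ)ᵀ = 1 := transpose_one
  have hU : (1 : Matrix (Fin 1) (Fin 1) ℝ) * (1 : Matrix (Fin 1) (Fin 1) ℝ)ᵀ = 1 := by
    rw [h1, mul_one]
  have hU' : (1 : Matrix (Fin 1) (Fin 1) ℝ)ᵀ * (1 : Matrix (Fin 1) (Fin 1) ℝ) = 1 := by
    rw [h1, mul_one]
  have hA1 : (0 : Matrix (Fin 1) (Fin 1) ℝ) = 1 * 0 * (1 : Matrix (Fin 1) (Fin 1) ℝ)ᵀ := by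
    simp
  have hB1 : B = 1 * !![B 0 0] * (1 : Matrix (Fin 1) (Fin 1) ℝ)ᵀ := by
    ext i j
    fin_cases i; fin_cases j
    simp
  refine ⟨B 0 0, ?_, (1 : Matrix (Fin 1) (Fin 1) ℝ), hU, hU', hA1, hB1⟩
  simpa [mul_apply] using congrFun (congrFun hsq 0) 0

theorem exists_unit_eigenvector {p q α : ℝ} (hα : α ^ 2 = p ^ 2 + q ^ 2) :
    ∃ v : Fin 2 → ℝ, v ⬝ᵥ v = 1 ∧ !![p, q; q, -p] *ᵥ v = α • v := by
  have hdet : (!![p, q; q, -p] - α • (1 : Matrix (Fin 2) (Fin 2) ℝ)).det = 0 := by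
    simp [det_fin_two]
    linear_combination hα
  obtain ⟨v, hv, hv0⟩ := exists_mulVec_eq_zero_iff.2 hdet
  have hpos : 0 < v ⬝ᵥ v := by
    simpa using dotProduct_star_self_pos_iff.2 hv
  have hs : √(v ⬝ᵥ v) ^ 2 = v ⬝ᵥ v := Real.sq_sqrt hpos.le
  have hs0 : √(v ⬝ᵥ v) ≠ 0 := (Real.sqrt_pos.2 hpos).ne'
  refine ⟨(√(v ⬝ᵥ v))⁻¹ • v, ?_, ?_⟩
  · rw [smul_dotProduct, dotProduct_smul, smul_eq_mul, smul_eq_mul]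
    nth_rewrite 3 [← hs]
    field_simp
  · rw [sub_mulVec, smul_mulVec, one_mulVec, sub_eq_zero] at hv0
    rw [mulVec_smul, hv0, smul_comm]

/-- By anticommutation `B` sends the `α`-eigenvector `v` of the traceless matrix `A` to a
`-α`-eigenvector, and `B² = 1 + A²` fixes its length as `√(1 + α²)`. In the resulting orthonormal
eigenbasis the pair has the model form. -/
theorem Atom.SatisfiesRelations.orthEquiv_atomTwo {a : Atom} (h : a.SatisfiesRelations)
    (hs : a.size = 2) (hA0 : a.A ≠ 0) : ∃ α, 0 < α ∧ (atomTwo α).OrthEquiv a := by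
  obtain ⟨n, hn, A, B, hA, hB⟩ := a
  obtain rfl : n = 2 := hs
  have hanti : A * B = -(B * A) := h.anticomm
  have hsq : B * B = 1 + A * A := h.sq_eq
  have htr : A.trace = 0 := h.trace_A
  change A ≠ 0 at hA0
  obtain ⟨p, hp⟩ : ∃ p, p = A 0 0 := ⟨_, rfl⟩
  obtain ⟨q, hq⟩ : ∃ q, q = A 0 1 := ⟨_, rfl⟩
  have hA' : A = !![p, q; q, -p] := by
    have h10 : A 1 0 = q := by rw [hq]; exact hA.apply 0 1
    have h11 : A 1 1 = -p := by rw [trace_fin_two, ← hp] at htr; linarith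
    ext i j
    fin_cases i <;> fin_cases j <;> simp [hp, hq, h10, h11]
  have hpq : 0 < p ^ 2 + q ^ 2 := by
    refine lt_of_le_of_ne (by positivity) fun h0 => hA0 ?_
    have hp0 : p = 0 := by nlinarith [sq_nonneg p, sq_nonneg q]
    have hq0 : q = 0 := by nlinarith [sq_nonneg p, sq_nonneg q]
    rw [hA', hp0, hq0]
    ext i j
    fin_cases i <;> fin_cases j <;> simp
  have hα2 : √(p ^ 2 + q ^ 2) ^ 2 = p ^ 2 + q ^ 2 := Real.sq_sqrt hpq.le
  have hα : 0 < √(p ^ 2 + q ^ 2) := Real.sqrt_pos.2 hpq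
  generalize √(p ^ 2 + q ^ 2) = α at hα hα2
  obtain ⟨v, hvv, hAv⟩ := exists_unit_eigenvector hα2
  rw [← hA'] at hAv
  have ht2 : √(1 + α ^ 2) ^ 2 = 1 + α ^ 2 := Real.sq_sqrt (by positivity)
  have ht0 : √(1 + α ^ 2) ≠ 0 := (Real.sqrt_pos.2 (by positivity)).ne'
  obtain ⟨t, ht⟩ : ∃ t, t = √(1 + α ^ 2) := ⟨_, rfl⟩
  rw [← ht] at ht2 ht0
  obtain ⟨w, hw⟩ : ∃ w, w = t⁻¹ • (B *ᵥ v) := ⟨_, rfl⟩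
  have hBv : B *ᵥ v = t • w := by rw [hw, smul_smul, mul_inv_cancel₀ ht0, one_smul]
  have hBBv : B *ᵥ (B *ᵥ v) = (1 + α ^ 2) • v := by
    rw [mulVec_mulVec, hsq, add_mulVec, one_mulVec, ← mulVec_mulVec, hAv, mulVec_smul, hAv,
      smul_smul, add_smul, one_smul, sq]
  have hBw : B *ᵥ w = t • v := by
    rw [hw, mulVec_smul, hBBv, ← ht2, smul_smul, sq, ← mul_assoc, inv_mul_cancel₀ ht0, one_mul]
  have hAw : A *ᵥ w = -α • w := by
    rw [hw, mulVec_smul, mulVec_mulVec, hanti, neg_mulVec, ← mulVec_mulVec, hAv, mulVec_smul,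
      smul_comm, neg_smul, smul_neg]
  have hsA : ∀ x y : Fin 2 → ℝ, x ⬝ᵥ (A *ᵥ y) = (A *ᵥ x) ⬝ᵥ y := by
    intro x y
    rw [dotProduct_mulVec, ← mulVec_transpose, hA.eq]
  have hsB : ∀ x y : Fin 2 → ℝ, x ⬝ᵥ (B *ᵥ y) = (B *ᵥ x) ⬝ᵥ y := by
    intro x y
    rw [dotProduct_mulVec, ← mulVec_transpose, hB.eq]
  -- Eigenvectors of a symmetric matrix for the distinct eigenvalues `α` and `-α`.
  have hvw : v ⬝ᵥ w = 0 := by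
    have := hsA v w
    rw [hAv, hAw, dotProduct_smul, smul_dotProduct, smul_eq_mul, smul_eq_mul] at this
    have : α * (v ⬝ᵥ w) = 0 := by linarith
    exact (mul_eq_zero.1 this).resolve_left hα.ne'
  have hww : w ⬝ᵥ w = 1 := by
    have := hsB v w
    rw [hBv, hBw, dotProduct_smul, smul_dotProduct, hvv, smul_eq_mul, smul_eq_mul] at this
    exact (mul_left_cancel₀ ht0 this).symm
  obtain ⟨U, hU⟩ : ∃ U : Matrix (Fin 2) (Fin 2) ℝ, U = (of ![v, w])ᵀ := ⟨_, rfl⟩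
  have hUU : Uᵀ * U = 1 := by
    have hwv : w ⬝ᵥ v = 0 := by rw [dotProduct_comm, hvw]
    ext i j
    rw [hU, transpose_transpose, mul_apply]
    fin_cases i <;> fin_cases j
    · simpa [dotProduct] using hvv
    · simpa [dotProduct] using hvw
    · simpa [dotProduct] using hwv
    · simpa [dotProduct] using hww
  have hUU' : U * Uᵀ = 1 := mul_eq_one_comm.1 hUU
  have hAU : A * U = U * !![α, 0; 0, -α] := by
    ext i j
    fin_cases j
    · simpa [hU, mul_apply, mulVec, dotProduct, mul_comm] using congrFun hAv i
    · simpa [hU, mul_apply, mulVec, dotProduct, mul_comm] using congrFun hAw i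
  have hBU : B * U = U * !![0, t; t, 0] := by
    ext i j
    fin_cases j
    · simpa [hU, mul_apply, mulVec, dotProduct, mul_comm] using congrFun hBv i
    · simpa [hU, mul_apply, mulVec, dotProduct, mul_comm] using congrFun hBw i
  refine ⟨α, hα, U, hUU', hUU, ?_, ?_⟩
  · change A = U * !![α, 0; 0, -α] * Uᵀ
    rw [← hAU, mul_assoc, hUU', mul_one]
  · change B = U * !![0, √(1 + α ^ 2); √(1 + α ^ 2), 0] * Uᵀ
    rw [← ht, ← hBU, mul_assoc, hUU', mul_one]

end BQTMP

namespace BQTMP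

open Letter Matrix

/-! ### Measures supported on the irreducible atoms -/

/-- The atoms `(0, 1)`, `(0, -1)` and the irreducible atom of size two with parameter `α`. -/
noncomputable def modelAtom (α : ℝ) : Fin 3 → Atom :=
  ![atomOne 1, atomOne (-1), atomTwo α]

theorem modelAtom_size (α : ℝ) (j : Fin 3) : (modelAtom α j).size = ![1, 1, 2] j := by
  fin_cases j <;> rfl

theorem Atom.OrthEquiv.refl (a : Atom) : a.OrthEquiv a :=
  ⟨1, by simp, by simp, by simp, by simp⟩

/-- The moments are affine in the three parameters, so convex combinations only average these. -/
theorem reducedMoment_combination {p₀ p₁ p₂ : ℝ} (hp : p₀ + p₁ + p₂ = 1) (α : ℝ) (w : WordLE 4) :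
    p₀ * reducedMoment 1 0 0 w.1 + p₁ * reducedMoment (-1) 0 0 w.1 +
      p₂ * reducedMoment 0 (α ^ 2) (α ^ 4) w.1 =
    reducedMoment (p₀ - p₁) (p₂ * α ^ 2) (p₂ * α ^ 4) w.1 := by
  refine forall_wordLE_four (P := fun w => p₀ * reducedMoment 1 0 0 w +
    p₁ * reducedMoment (-1) 0 0 w + p₂ * reducedMoment 0 (α ^ 2) (α ^ 4) w =
    reducedMoment (p₀ - p₁) (p₂ * α ^ 2) (p₂ * α ^ 4) w) ?_ ?_ ?_ ?_ ?_ w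
  · simp only [reducedMoment]
    linarith
  · rintro (_ | _) <;> simp only [reducedMoment] <;> linarith
  · rintro (_ | _) (_ | _) <;> simp only [reducedMoment] <;> linarith
  · rintro (_ | _) (_ | _) (_ | _) <;> simp only [reducedMoment] <;> linarith
  · rintro (_ | _) (_ | _) (_ | _) (_ | _) <;> simp only [reducedMoment] <;> linarith

namespace AtomicMeasure

/-- The total density of the atoms in the class `j`. -/
def classWeight (μ : AtomicMeasure) (κ : Fin μ.N → Fin 3) (j : Fin 3) : ℝ :=
  ∑ i with κ i = j, μ.density i

theorem sum_classWeight (μ : AtomicMeasure) (κ : Fin μ.N → Fin 3) :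
    μ.classWeight κ 0 + μ.classWeight κ 1 + μ.classWeight κ 2 = 1 := by
  rw [← Fin.sum_univ_three (μ.classWeight κ), ← μ.density_sum]
  exact Finset.sum_fiberwise _ _ _

theorem sum_density_mul_trace (μ : AtomicMeasure) {κ : Fin μ.N → Fin 3} {α : ℝ}
    (hκ : ∀ i, (modelAtom α (κ i)).OrthEquiv (μ.atom i)) (w : WordLE 4) :
    ∑ i, μ.density i * (μ.atom i).trace w.1 =
      reducedMoment (μ.classWeight κ 0 - μ.classWeight κ 1) (μ.classWeight κ 2 * α ^ 2)
        (μ.classWeight κ 2 * α ^ 4) w.1 := by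
  rw [← reducedMoment_combination (μ.sum_classWeight κ), ← atomTwo_trace,
    ← atomOne_trace (by norm_num), ← atomOne_trace (by norm_num)]
  have := Fin.sum_univ_three fun j => μ.classWeight κ j * (modelAtom α j).trace w.1
  refine Eq.trans ?_ this
  simp only [classWeight, Finset.sum_mul]
  rw [← Finset.sum_fiberwise Finset.univ κ]
  refine Finset.sum_congr rfl fun j _ => Finset.sum_congr rfl fun i hi => ?_
  rw [← (hκ i).trace_eq, (Finset.mem_filter.1 hi).2]

theorem classWeight_pos_iff (μ : AtomicMeasure) (κ : Fin μ.N → Fin 3) (j : Fin 3) :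
    0 < μ.classWeight κ j ↔ j ∈ Finset.univ.image κ := by
  constructor
  · intro h
    obtain ⟨i, hi, -⟩ := Finset.exists_ne_zero_of_sum_ne_zero h.ne'
    exact Finset.mem_image.2 ⟨i, Finset.mem_univ i, (Finset.mem_filter.1 hi).2⟩
  · intro h
    obtain ⟨i, -, hi⟩ := Finset.mem_image.1 h
    exact Finset.sum_pos (fun i _ => μ.density_pos i) ⟨i, Finset.mem_filter.2 ⟨Finset.mem_univ i, hi⟩⟩

/-- The measure with density `p j` at the `j`-th model atom, where the atoms with `p j = 0` are
left out. -/
noncomputable def model (p : Fin 3 → ℝ) (α : ℝ) (hp : ∑ j with 0 < p j, p j = 1) :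
    AtomicMeasure where
  N := (Finset.univ.filter (0 < p ·)).card
  atom i := modelAtom α ((Finset.univ.filter (0 < p ·)).orderEmbOfFin rfl i)
  density i := p ((Finset.univ.filter (0 < p ·)).orderEmbOfFin rfl i)
  density_pos i := (Finset.mem_filter.1 (Finset.orderEmbOfFin_mem _ rfl i)).2
  density_sum := by
    rw [← hp, ← Finset.sum_coe_sort (Finset.univ.filter (0 < p ·))]
    exact Equiv.sum_comp ((Finset.univ.filter (0 < p ·)).orderIsoOfFin rfl).toEquiv
      fun j => p j

/-- The classes of the atoms of the model measure. -/
noncomputable def modelClass (p : Fin 3 → ℝ) (α : ℝ) (hp : ∑ j with 0 < p j, p j = 1) :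
    Fin (model p α hp).N → Fin 3 :=
  (Finset.univ.filter (0 < p ·)).orderEmbOfFin rfl

section Model

variable {p : Fin 3 → ℝ} {α : ℝ} {hp : ∑ j with 0 < p j, p j = 1}

theorem modelClass_injective : Function.Injective (modelClass p α hp) :=
  (Finset.orderEmbOfFin _ rfl).injective

theorem range_modelClass (j : Fin 3) : (∃ i, modelClass p α hp i = j) ↔ 0 < p j := by
  have h := Set.ext_iff.1 (Finset.range_orderEmbOfFin (Finset.univ.filter (0 < p ·)) rfl) j
  rw [Finset.mem_coe, Finset.mem_filter, and_iff_right (Finset.mem_univ j)] at h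
  exact h

theorem model_classWeight (h0 : ∀ j, 0 ≤ p j) (j : Fin 3) :
    (model p α hp).classWeight (modelClass p α hp) j = p j := by
  rcases (h0 j).eq_or_lt with hj | hj
  · rw [classWeight, ← hj]
    refine Finset.sum_eq_zero fun i hi => ?_
    have := (range_modelClass j).1 ⟨i, (Finset.mem_filter.1 hi).2⟩
    exact absurd this (by rw [← hj]; exact lt_irrefl 0)
  · obtain ⟨i, hi⟩ := (range_modelClass (α := α) (hp := hp) j).2 hj
    rw [classWeight, Finset.sum_eq_single_of_mem i (Finset.mem_filter.2 ⟨Finset.mem_univ i, hi⟩)]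
    · exact congrArg p hi
    · intro k hk hne
      exact absurd (modelClass_injective ((Finset.mem_filter.1 hk).2.trans hi.symm)) hne

theorem model_represents (h0 : ∀ j, 0 ≤ p j) {β : TracialSeq}
    (hβ : ∀ w : WordLE 4, β.toFun w = reducedMoment (p 0 - p 1) (p 2 * α ^ 2) (p 2 * α ^ 4) w.1) :
    (model p α hp).Represents β := by
  intro w
  rw [hβ w, sum_density_mul_trace _ (κ := modelClass p α hp) (α := α)
    fun i => Atom.OrthEquiv.refl _]
  simp only [model_classWeight h0]

theorem model_atom_size (i : Fin (model p α hp).N) :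
    ((model p α hp).atom i).size = ![1, 1, 2] (modelClass p α hp i) :=
  modelAtom_size _ _

theorem model_maxSize (h2 : 0 < p 2) : (model p α hp).maxSize = 2 := by
  refine le_antisymm (Finset.sup_le fun i _ => ?_) ?_
  · rw [model_atom_size]
    generalize modelClass p α hp i = j
    fin_cases j <;> simp
  · obtain ⟨i, hi⟩ := (range_modelClass (α := α) (hp := hp) 2).2 h2
    have := (model p α hp).size_le_maxSize i
    rw [model_atom_size, hi] at this
    simpa using this

theorem model_mult_two (h2 : 0 < p 2) : (model p α hp).mult 2 = 1 := by
  obtain ⟨i, hi⟩ := (range_modelClass (α := α) (hp := hp) 2).2 h2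
  refine Finset.card_eq_one.2 ⟨i, ?_⟩
  ext k
  simp only [Finset.mem_filter, Finset.mem_univ, true_and, Finset.mem_singleton, model_atom_size]
  constructor
  · intro hk
    refine modelClass_injective (α := α) (hp := hp) ?_
    rw [hi]
    generalize modelClass p α hp k = j at hk
    fin_cases j <;> simp_all
  · rintro rfl
    rw [hi]
    rfl

end Model

theorem mult_add_mult {μ : AtomicMeasure} (h : μ.maxSize = 2) : μ.mult 1 + μ.mult 2 = μ.N := by
  have h12 : ∀ i, (μ.atom i).size = 2 ↔ ¬ (μ.atom i).size = 1 := by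
    intro i
    have h1 := μ.size_le_maxSize i
    have h2 := (μ.atom i).size_pos
    omega
  simp only [mult, h12]
  rw [Finset.card_filter_add_card_filter_not, Finset.card_univ, Fintype.card_fin]

theorem type_eq {μ : AtomicMeasure} (h : μ.maxSize = 2) : μ.type = [μ.mult 1, μ.mult 2] := by
  simp [type, h, List.range_succ]

theorem mult_maxSize_pos (μ : AtomicMeasure) : 0 < μ.mult μ.maxSize := by
  obtain ⟨i, hi⟩ := μ.exists_size_eq_maxSize
  exact Finset.card_pos.2 ⟨i, Finset.mem_filter.2 ⟨Finset.mem_univ i, hi⟩⟩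

/-- A representing measure with a single atom of size two and no larger ones is supported on the
irreducible atoms. -/
theorem Represents.exists_class {ν : AtomicMeasure} {β : TracialSeq} (h : ν.Represents β)
    (hrel₁ : β.column [X, Y] + β.column [Y, X] = 0)
    (hrel₂ : β.column [Y, Y] - β.column [X, X] = β.column []) (ha : 0 < β.moment [X, X])
    (hmax : ν.maxSize = 2) (hmult : ν.mult 2 = 1) :
    ∃ α > 0, ∃ κ : Fin ν.N → Fin 3, ∀ i, (modelAtom α (κ i)).OrthEquiv (ν.atom i) := by
  obtain ⟨i₂, hi₂⟩ := Finset.card_eq_one.1 hmult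
  have hsize : ∀ i, (ν.atom i).size = 2 ↔ i = i₂ := by
    intro i
    have := Finset.ext_iff.1 hi₂ i
    simpa using this
  have hone : ∀ i, i ≠ i₂ → (ν.atom i).size = 1 := by
    intro i hi
    have h1 := ν.size_le_maxSize i
    have h2 := (ν.atom i).size_pos
    have h3 := mt (hsize i).1 hi
    omega
  have hrel := h.satisfiesRelations hrel₁ hrel₂
  -- The atoms of size one have `A = 0`, so the atom of size two alone must produce `β_{X²} > 0`.
  have hA : (ν.atom i₂).A ≠ 0 := by
    intro h0
    refine ha.ne' ((h _).trans (Finset.sum_eq_zero fun i _ => ?_))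
    by_cases hi : i = i₂
    · subst hi
      simp [Atom.trace, Atom.eval, h0]
    · obtain ⟨b, hb, hob⟩ := (hrel i).orthEquiv_atomOne (hone i hi)
      rw [← hob.trace_eq, atomOne_trace (by rw [sq, hb])]
      exact mul_zero _
  obtain ⟨α, hα, hα2⟩ := (hrel i₂).orthEquiv_atomTwo ((hsize i₂).2 rfl) hA
  have hex : ∀ i, ∃ j, (modelAtom α j).OrthEquiv (ν.atom i) := by
    intro i
    by_cases hi : i = i₂
    · subst hi
      exact ⟨2, hα2⟩
    · obtain ⟨b, hb, hob⟩ := (hrel i).orthEquiv_atomOne (hone i hi)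
      rcases mul_self_eq_one_iff.1 hb with rfl | rfl
      · exact ⟨0, hob⟩
      · exact ⟨1, hob⟩
  choose κ hκ using hex
  exact ⟨α, hα, κ, hκ⟩

/-- The occupied classes are those of positive weight, and `ν` has no more atoms than there are such
classes. So each occupied class contains exactly one atom, which carries the whole class weight. -/
theorem model_orthEquiv {p : Fin 3 → ℝ} {α : ℝ} {hp : ∑ j with 0 < p j, p j = 1}
    {ν : AtomicMeasure} {κ : Fin ν.N → Fin 3}
    (hκ : ∀ i, (modelAtom α (κ i)).OrthEquiv (ν.atom i)) (hw : ∀ j, ν.classWeight κ j = p j)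
    (hN : ν.N ≤ (model p α hp).N) : (model p α hp).OrthEquiv ν := by
  have himage : Finset.univ.image κ = Finset.univ.filter (0 < p ·) := by
    ext j
    rw [← ν.classWeight_pos_iff, hw]
    simp
  have hinj : Function.Injective κ := by
    rw [← Set.injOn_univ, ← Finset.coe_univ, ← Finset.card_image_iff]
    refine le_antisymm Finset.card_image_le ?_
    rw [himage, Finset.card_univ, Fintype.card_fin]
    exact hN
  have hex : ∀ i, ∃ k, κ k = modelClass p α hp i := by
    intro i
    have : modelClass p α hp i ∈ Finset.univ.image κ := by
      rw [himage, Finset.mem_filter]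
      exact ⟨Finset.mem_univ _, (range_modelClass _).1 ⟨i, rfl⟩⟩
    simpa using this
  choose e he using hex
  have hbij : Function.Bijective e := by
    constructor
    · intro i k hik
      exact modelClass_injective (by rw [← he, ← he, hik])
    · intro k
      have hk : κ k ∈ Finset.univ.filter (0 < p ·) :=
        himage ▸ Finset.mem_image_of_mem κ (Finset.mem_univ k)
      obtain ⟨i, hi⟩ := (range_modelClass (α := α) (hp := hp) (κ k)).2 (Finset.mem_filter.1 hk).2
      exact ⟨i, hinj ((he i).trans hi)⟩
  refine ⟨Equiv.ofBijective e hbij, fun i => ⟨?_, ?_⟩⟩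
  · change ν.density (e i) = p (modelClass p α hp i)
    rw [← hw, classWeight, Finset.sum_eq_single_of_mem (e i) (by simp [he])]
    intro k hk hne
    exact absurd (hinj ((Finset.mem_filter.1 hk).2.trans (he i).symm)) hne
  · change (modelAtom α (modelClass p α hp i)).OrthEquiv (ν.atom (e i))
    rw [← he]
    exact hκ _

end AtomicMeasure

end BQTMP

namespace BQTMP

open Letter Matrix AtomicMeasure

/-! ### Existence and uniqueness of the minimal measure -/

/-- The densities of the minimal measure, in terms of `y = β_Y` and the density `q` of the atom of
size two. -/
noncomputable def minimalWeight (y q : ℝ) : Fin 3 → ℝ :=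
  ![(1 - q + y) / 2, (1 - q - y) / 2, q]

theorem minimalWeight_nonneg {y q : ℝ} (hq : 0 < q) (hqy : q ≤ 1 - |y|) (j : Fin 3) :
    0 ≤ minimalWeight y q j := by
  have h1 := le_abs_self y
  have h2 := neg_abs_le y
  fin_cases j
  · change 0 ≤ (1 - q + y) / 2
    linarith
  · change 0 ≤ (1 - q - y) / 2
    linarith
  · exact hq.le

theorem sum_minimalWeight {y q : ℝ} (hq : 0 < q) (hqy : q ≤ 1 - |y|) :
    ∑ j with 0 < minimalWeight y q j, minimalWeight y q j = 1 := by
  rw [Finset.sum_filter_of_ne fun j _ hj => (minimalWeight_nonneg hq hqy j).lt_of_ne' hj,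
    Fin.sum_univ_three]
  change (1 - q + y) / 2 + (1 - q - y) / 2 + q = 1
  ring

/-- The number of atoms of the minimal measure. -/
noncomputable def minimalCard (y q : ℝ) : ℕ :=
  (Finset.univ.filter (0 < minimalWeight y q ·)).card

theorem minimalCard_eq (y q : ℝ) : minimalCard y q = (if 0 < (1 - q + y) / 2 then 1 else 0) +
    (if 0 < (1 - q - y) / 2 then 1 else 0) + (if 0 < q then 1 else 0) := by
  rw [minimalCard, Finset.card_filter, Fin.sum_univ_three]
  rfl

theorem minimalCard_of_lt {y q : ℝ} (hq : 0 < q) (hqy : q < 1 - |y|) : minimalCard y q = 3 := by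
  have h1 := le_abs_self y
  have h2 := neg_abs_le y
  rw [minimalCard_eq, if_pos (by linarith), if_pos (by linarith), if_pos hq]

theorem minimalCard_of_eq {y q : ℝ} (hq : 0 < q) (hqy : q = 1 - |y|) (hy : 0 < |y|) :
    minimalCard y q = 2 := by
  rw [minimalCard_eq]
  rcases abs_cases y with ⟨h, -⟩ | ⟨h, -⟩
  · rw [if_pos (by linarith), if_neg (by linarith), if_pos hq]
  · rw [if_neg (by linarith), if_pos (by linarith), if_pos hq]

/-- The class weights and `α` solve `p₀ + p₁ + p₂ = 1`, `p₀ - p₁ = y`, `p₂α² = a`, `p₂α⁴ = c`, a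
system with a single solution with `α > 0`. The `- 1` in the type discounts the atom of size two. -/
theorem TracialSeq.hasUniqueMinimalMeasure {β : TracialSeq} (hnorm : β.Normalized)
    (hnc : β.Noncommutative) (hrel₁ : β.column [X, Y] + β.column [Y, X] = 0)
    (hrel₂ : β.column [Y, Y] - β.column [X, X] = β.column []) (hX : β.moment [X] = 0)
    (ha : 0 < β.moment [X, X]) (hc : 0 < β.moment [X, X, X, X])
    (hle : β.moment [X, X] ^ 2 / β.moment [X, X, X, X] ≤ 1 - |β.moment [Y]|) :
    β.HasUniqueMinimalMeasure ∧ ∀ ν : AtomicMeasure, ν.IsMinimal β → ν.type =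
      [minimalCard (β.moment [Y]) (β.moment [X, X] ^ 2 / β.moment [X, X, X, X]) - 1, 1] := by
  have hred := β.toFun_eq_reducedMoment hnorm hrel₁ hrel₂ hX
  have ha' := ha
  set y := β.moment [Y] with hy
  set a := β.moment [X, X] with hadef
  set c := β.moment [X, X, X, X] with hcdef
  obtain ⟨q, hq⟩ : ∃ q, q = a ^ 2 / c := ⟨_, rfl⟩
  obtain ⟨α, hα⟩ : ∃ α, α = √(c / a) := ⟨_, rfl⟩
  have hα2 : α ^ 2 = c / a := by rw [hα, Real.sq_sqrt (by positivity)]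
  have hα4 : α ^ 4 = (c / a) ^ 2 := by rw [← hα2]; ring
  have hq0 : 0 < q := by rw [hq]; positivity
  rw [← hq] at hle ⊢
  have hp := sum_minimalWeight hq0 hle
  have hrep : (model (minimalWeight y q) α hp).Represents β := by
    refine model_represents (minimalWeight_nonneg hq0 hle) fun w => (hred w).trans ?_
    congr 1
    · change y = (1 - q + y) / 2 - (1 - q - y) / 2
      ring
    · change a = q * α ^ 2
      rw [hα2, hq]
      field_simp
    · change c = q * α ^ 4
      rw [hα4, hq]
      field_simp
  have hmax : (model (minimalWeight y q) α hp).maxSize = 2 := model_maxSize hq0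
  have hmult : (model (minimalWeight y q) α hp).mult 2 = 1 := model_mult_two hq0
  have hN : (model (minimalWeight y q) α hp).N = minimalCard y q := rfl
  have hsum := mult_add_mult hmax
  rw [hmult, hN] at hsum
  generalize hμ : model (minimalWeight y q) α hp = μ at hrep hmax hmult hN hsum
  have hclass : ∀ ν : AtomicMeasure, ν.Represents β → ν.maxSize = 2 → ν.mult 2 = 1 →
      ∃ κ : Fin ν.N → Fin 3, (∀ i, (modelAtom α (κ i)).OrthEquiv (ν.atom i)) ∧
        ∀ j, ν.classWeight κ j = minimalWeight y q j := by
    intro ν hν hνmax hνmult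
    obtain ⟨α', hα', κ, hκ⟩ := hν.exists_class hrel₁ hrel₂ ha' hνmax hνmult
    have hmom : ∀ w : WordLE 4, reducedMoment y a c w.1 = _ :=
      fun w => ((hred w).symm.trans (hν w)).trans (ν.sum_density_mul_trace hκ w)
    have e0 := ν.sum_classWeight κ
    have e1 : y = ν.classWeight κ 0 - ν.classWeight κ 1 := hmom ⟨[Y], by decide⟩
    have e2 : a = ν.classWeight κ 2 * α' ^ 2 := hmom ⟨[X, X], by decide⟩
    have e3 : c = ν.classWeight κ 2 * α' ^ 4 := hmom ⟨[X, X, X, X], by decide⟩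
    have hw2 : ν.classWeight κ 2 ≠ 0 := by
      intro h0
      rw [h0, zero_mul] at e2
      exact ha.ne' e2
    have hαα : α' = α := by
      rw [hα, e2, e3, eq_comm, Real.sqrt_eq_iff_mul_self_eq_of_pos hα']
      field_simp
    subst hαα
    have e4 : ν.classWeight κ 2 = q := by
      rw [hq, e2, e3]
      field_simp
    refine ⟨κ, hκ, fun j => ?_⟩
    fin_cases j
    · change ν.classWeight κ 0 = (1 - q + y) / 2
      linarith
    · change ν.classWeight κ 1 = (1 - q - y) / 2
      linarith
    · exact e4
  have hcard : ∀ ν : AtomicMeasure, ν.Represents β → ν.maxSize = 2 → ν.mult 2 = 1 →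
      minimalCard y q ≤ ν.N := by
    intro ν hν hνmax hνmult
    obtain ⟨κ, -, hw⟩ := hclass ν hν hνmax hνmult
    have himage : Finset.univ.filter (0 < minimalWeight y q ·) = Finset.univ.image κ := by
      ext j
      rw [← ν.classWeight_pos_iff, hw]
      simp
    rw [minimalCard, himage]
    exact Finset.card_image_le.trans (by simp)
  -- Noncommutativity forces maximal size at least two, so `m₂ ≥ 1` for a competitor of maximal size
  -- two. Once `m₂ = 1`, `hcard` bounds `m₁` from below.
  have hmin : μ.IsMinimal β := by
    refine ⟨hrep, fun ν hν hsm => ?_⟩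
    have h1 := hν.one_lt_maxSize hnc
    rcases hsm with hlt | ⟨heq, s, hs1, hs2, hslt, hst⟩
    · omega
    · rw [hmax] at heq hs2
      have hpos := ν.mult_maxSize_pos
      rw [heq] at hpos
      obtain rfl | rfl : s = 1 ∨ s = 2 := by omega
      · have h2 : ν.mult 2 = 1 := by rw [hst 2 (by norm_num) (by rw [hmax]), hmult]
        have h3 := hcard ν hν heq h2
        have h4 := mult_add_mult heq
        omega
      · omega
  have hstruct : ∀ ν : AtomicMeasure, ν.IsMinimal β →
      ν.maxSize = 2 ∧ ν.mult 2 = 1 ∧ ν.N = minimalCard y q := by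
    intro ν hν
    -- Comparison with `μ` bounds first the maximal size, then `m₂`, then `m₁` of another minimal
    -- measure.
    have hns := hν.2 μ hrep
    simp only [Smaller, not_or, not_lt, not_and, not_exists] at hns
    obtain ⟨h1, h2⟩ := hns
    have h3 := hν.1.one_lt_maxSize hnc
    have h4 : ν.maxSize = 2 := by omega
    have hpos := ν.mult_maxSize_pos
    rw [h4] at hpos h2
    have h5 : ν.mult 2 = 1 := by
      by_contra hne
      exact h2 hmax 2 (by norm_num) le_rfl (by omega) fun t h5 h6 => by omega
    have h6 := mult_add_mult h4
    have h7 := hcard ν hν.1 h4 h5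
    refine ⟨h4, h5, ?_⟩
    by_contra hne
    refine h2 hmax 1 le_rfl (by norm_num) (by omega) fun t h8 h9 => ?_
    obtain rfl : t = 2 := by omega
    rw [hmult, h5]
  refine ⟨⟨μ, hmin, fun ν hν => ?_⟩, fun ν hν => ?_⟩
  · obtain ⟨h1, h2, h3⟩ := hstruct ν hν
    obtain ⟨κ, hκ, hw⟩ := hclass ν hν.1 h1 h2
    rw [← hμ]
    exact model_orthEquiv hκ hw (by rw [hμ, hN, h3])
  · obtain ⟨h1, h2, h3⟩ := hstruct ν hν
    have h4 := mult_add_mult h1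
    rw [type_eq h1, h2]
    congr 1
    omega

end BQTMP

open BQTMP BQTMP.Letter in
theorem theorem6p10 (β : TracialSeq) (hnorm : β.Normalized) (hnc : β.Noncommutative)
    (hrank : β.M₂.rank = 5)
    (hrel₁ : β.column [X, Y] + β.column [Y, X] = 0)
    (hrel₂ : β.column [Y, Y] - β.column [X, X] = β.column []) :
    (β.AdmitsNCMeasure ↔
      (β.M₂.PosSemidef ∧ β.moment [X] = 0 ∧ β.moment [Y] = 0) ∨
      (β.M₂.PosSemidef ∧ β.CondTwo)) ∧
    (β.M₂.PosSemidef → β.moment [X] = 0 → β.moment [Y] = 0 →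
      β.HasUniqueMinimalMeasure ∧
      ∀ μ : AtomicMeasure, μ.IsMinimal β → μ.type = [2, 1]) ∧
    (β.M₂.PosSemidef → β.CondTwo →
      β.HasUniqueMinimalMeasure ∧
      ∀ μ : AtomicMeasure, μ.IsMinimal β →
        (μ.type = [1, 1] ↔
          β.moment [X, X, X, X] = β.moment [X, X] ^ 2 / (1 - |β.moment [Y]|)) ∧
        (β.moment [X, X, X, X] ≠ β.moment [X, X] ^ 2 / (1 - |β.moment [Y]|) →
          μ.type = [2, 1])) := by
  have case₁ : β.M₂.PosSemidef → β.moment [X] = 0 → β.moment [Y] = 0 →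
      β.HasUniqueMinimalMeasure ∧ ∀ μ : AtomicMeasure, μ.IsMinimal β → μ.type = [2, 1] := by
    intro hM hX hY
    have ha := TracialSeq.moment_sq_pos hnorm hrel₁ hrel₂ hrank hX hM
    have hlt := TracialSeq.moment_sq_lt hnorm hrel₁ hrel₂ hrank hX hY hM
    have hc := (sq_nonneg _).trans_lt hlt
    have hq : β.moment [X, X] ^ 2 / β.moment [X, X, X, X] < 1 - |β.moment [Y]| := by
      rw [hY, abs_zero, sub_zero, div_lt_one hc]
      exact hlt
    have := TracialSeq.hasUniqueMinimalMeasure hnorm hnc hrel₁ hrel₂ hX ha hc hq.le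
    rwa [minimalCard_of_lt (by positivity) hq] at this
  have case₂ : β.M₂.PosSemidef → β.CondTwo →
      β.HasUniqueMinimalMeasure ∧ ∀ μ : AtomicMeasure, μ.IsMinimal β →
        (μ.type = [1, 1] ↔
          β.moment [X, X, X, X] = β.moment [X, X] ^ 2 / (1 - |β.moment [Y]|)) ∧
        (β.moment [X, X, X, X] ≠ β.moment [X, X] ^ 2 / (1 - |β.moment [Y]|) →
          μ.type = [2, 1]) := by
    rintro hM ⟨hX, hy0, hy1, hge⟩
    have ha := TracialSeq.moment_sq_pos hnorm hrel₁ hrel₂ hrank hX hM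
    have hy : 0 < 1 - |β.moment [Y]| := sub_pos.2 hy1
    have hc : 0 < β.moment [X, X, X, X] := lt_of_lt_of_le (by positivity) hge
    have hq : β.moment [X, X] ^ 2 / β.moment [X, X, X, X] ≤ 1 - |β.moment [Y]| := by
      rw [div_le_iff₀ hc, mul_comm]
      exact (div_le_iff₀ hy).1 hge
    have hiff : β.moment [X, X] ^ 2 / β.moment [X, X, X, X] = 1 - |β.moment [Y]| ↔
        β.moment [X, X, X, X] = β.moment [X, X] ^ 2 / (1 - |β.moment [Y]|) := by
      rw [div_eq_iff hc.ne', eq_div_iff hy.ne', mul_comm, eq_comm]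
    obtain ⟨h1, h2⟩ := TracialSeq.hasUniqueMinimalMeasure hnorm hnc hrel₁ hrel₂ hX ha hc hq
    refine ⟨h1, fun μ hμ => ?_⟩
    rw [Ne, ← hiff, h2 μ hμ]
    rcases hq.eq_or_lt with heq | hlt
    · rw [minimalCard_of_eq (by positivity) heq hy0]
      simp [heq]
    · rw [minimalCard_of_lt (by positivity) hlt]
      simp [hlt.ne]
  have exists_large : β.HasUniqueMinimalMeasure → β.AdmitsNCMeasure := by
    rintro ⟨μ, hμ, -⟩
    exact ⟨μ, hμ, hμ.1.one_lt_maxSize hnc⟩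
  refine ⟨⟨?_, ?_⟩, case₁, case₂⟩
  · rintro ⟨μ, hμ, -⟩
    have hM := hμ.1.posSemidef
    have hX := hμ.1.moment_X hrel₁ hrel₂
    have hle := hμ.1.sq_le_mul hrel₁ hrel₂
    by_cases hY : β.moment [Y] = 0
    · exact .inl ⟨hM, hX, hY⟩
    · have ha := TracialSeq.moment_sq_pos hnorm hrel₁ hrel₂ hrank hX hM
      have hc : 0 ≤ β.moment [X, X, X, X] := hM.diag_nonneg (i := 3)
      -- Because `0 < a² ≤ c (1 - |y|)` with `c ≥ 0`.
      have hy : 0 < 1 - |β.moment [Y]| :=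
        pos_of_mul_pos_right (lt_of_lt_of_le (by positivity) hle) hc
      exact .inr ⟨hM, hX, abs_pos.2 hY, sub_pos.1 hy, (div_le_iff₀ hy).2 hle⟩
  · rintro (⟨hM, hX, hY⟩ | ⟨hM, h⟩)
    · exact exists_large (case₁ hM hX hY).1
    · exact exists_large (case₂ hM h).1
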